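/- Write $S^1=\mathbb R/2\pi\mathbb Z$; $\|\cdot\|$ denotes Euclidean norms and the associated operator norms. **Theorem.** Let $M$ be a smooth manifold of dimension $n$, and let $G_1,\dots,G_m\in C^\infty(S^1\times M,\mathrm TM)$ be smooth $2\pi$-periodic time-varying vector fields on $M$. For $(\theta,x)\in S^1\times M$ and $j\ge 0$ let $\frac{\partial^jG}{\partial\theta^j}(\theta,x):\mathbb R^m\to \mathrm T_xM$ be the linear map $u\mapsto\sum_i u_i\frac{\partial^jG_i}{\partial\theta^j}(\theta,x)$, and for $p\in \mathrm T^*_xM$ let $\langle p,\frac{\partial^jG}{\partial\theta^j}(\theta,x)\rangle=\bigl(\langle p,\frac{\partial^jG_i}{\partial\theta^j}(\theta,x)\rangle\bigr)_{1\le i\le m}$. Define $$H:\mathrm T^*M\to[0,\infty),\qquad H(x,p)=\frac1{2\pi}\int_0^{2\pi}\|\langle p,G(\theta,x)\rangle\|\,d\theta .$$ Assume the full rank condition: for all $(\theta,x)\in S^1\times M$, $$\dim\sum_{j\ge0}\operatorname{Range}\frac{\partial^jG}{\partial\theta^j}(\theta,x)=n,$$ and assume that (i) for all $(x,p)\in \mathrm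 T^*M$ with $p\ne0$ there is at most one $\theta\in S^1$ such that $\langle p,G(\theta,x)\rangle=0$, and $\langle p,\frac{\partial G}{\partial\theta}(\theta,x)\rangle\neq 0$ at such a $\theta$; (ii) $\operatorname{rank}G(\theta,x)=m$ for all $(\theta,x)\in S^1\times M$. Then for every $(\bar x,\bar p)\in \mathrm T^*M$ with $\bar p\neq0$, and in the coordinates of $\mathrm T^*M$ induced by any chart of $M$ around $\bar x$, there are a constant $c>0$ and an open neighborhood of $(\bar x,\bar p)$ on which $H$ is continuously differentiable and such that, for all $X,Y\in\mathbb R^{2n}$ that are coordinates of points of this neighborhood, $$\|dH(Y)-dH(X)\|\le c\,\|X-Y\|\ln\frac1{\|X-Y\|}$$ (the right-hand side being $0$ for $X=Y$). **Proposition.** Let $d$ be a positive integer, $m\ge 0$ an integer, $\Omega$ an open subset of $\mathbb R^d$, $V:S^1\times\Omega\to\mathbb R^m$ a smooth ($C^\infty$) map, and $$\mathsf H(X)=\frac1{2\pi}\int_0^{2\pi}\|V(\theta,X)\|\,d\theta,\qquad \widetilde{\mathcal Z}=\{X\in\Omega:\ \exists\,\theta\in S^1,\ V(\theta,X)=0\}.$$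 1. If for every $X\in\Omega$ the set $\{\theta\in S^1: V(\theta,X)=0\}$ has measure zero, then $\mathsf H$ is continuously differentiable on $\Omega$ and, for all $X\in\Omega$ and $h\in\mathbb R^d$, $$d\mathsf H(X).h=\frac1{2\pi}\int_0^{2\pi}\Bigl\langle\frac{\partial V}{\partial X}(\theta,X).h,\ \frac{V(\theta,X)}{\|V(\theta,X)\|}\Bigr\rangle d\theta,$$ where the integrand is integrable. 2. Assume that for every $X\in\Omega$ there is at most one $\theta\in S^1$ with $V(\theta,X)=0$, and that $V$ and $\partial V/\partial\theta$ do not vanish simultaneously on $S^1\times\Omega$. (No further nondegeneracy condition on $V$ at its zeros is required.) Then every $\bar X\in\widetilde{\mathcal Z}$ has an open neighborhood $O\subset\Omega$ and a constant $K>0$ such that $\mathsf H$ is continuously differentiable on $O$ and, for all $X,Y\in O$, $$\|d\mathsf H(X)-d\mathsf H(Y)\|\le K\,\|X-Y\|\ln\frac1{\|X-Y\|}.$$ -/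

import Mathlib

open MeasureTheory
open scoped ContDiff Manifold RealInnerProductSpace Topology

noncomputable section

namespace FastOsc

/-- A fast oscillating control system on an `n`-dimensional smooth manifold `M`, with control in
`ℝ^m`: the vector fields `G₁, …, G_m`, smooth on `S¹ × M`. Maps on the circle `S¹ = ℝ / 2πℤ` are
identified with `2π`-periodic maps on `ℝ`. -/
structure System (n m : ℕ) (M : Type*) [TopologicalSpace M]
    [ChartedSpace (EuclideanSpace ℝ (Fin n)) M] [IsManifold (𝓡 n) ∞ M] where
  G : ℝ → Fin m → (x : M) → TangentSpace (𝓡 n) x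
  periodic : ∀ θ i x, G (θ + 2 * Real.pi) i x = G θ i x
  smooth : ∀ i, ContMDiff (𝓘(ℝ, ℝ).prod (𝓡 n)) (𝓡 n).tangent ∞
    (fun z : ℝ × M => (⟨z.2, G z.1 i z.2⟩ : TangentBundle (𝓡 n) M))

section

variable {n m : ℕ} {M : Type*} [TopologicalSpace M]
  [ChartedSpace (EuclideanSpace ℝ (Fin n)) M] [IsManifold (𝓡 n) ∞ M]

/-- The partial derivative `∂ʲG_i/∂θʲ (θ, x) ∈ T_x M`: a derivative of a curve in the fixed vector
space `T_x M`, which in Mathlib is the model space `ℝ^n`. -/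
def System.dG (S : System n m M) (j : ℕ) (θ : ℝ) (i : Fin m) (x : M) : TangentSpace (𝓡 n) x :=
  iteratedDeriv (F := EuclideanSpace ℝ (Fin n)) j (fun t => S.G t i x) θ

/-- `∂ʲG/∂θʲ (θ, x)` as the linear map `ℝ^m → T_x M`, `u ↦ ∑ i, u i • ∂ʲG_i/∂θʲ (θ, x)`. -/
def System.opG (S : System n m M) (j : ℕ) (θ : ℝ) (x : M) :
    (Fin m → ℝ) →ₗ[ℝ] TangentSpace (𝓡 n) x :=
  Fintype.linearCombination ℝ (fun i => S.dG j θ i x)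

/-- `r(θ, x)`, the dimension of the sum over `j` of the ranges of `∂ʲG/∂θʲ (θ, x)`. -/
def System.r (S : System n m M) (θ : ℝ) (x : M) : ℕ :=
  Module.finrank ℝ (⨆ j : ℕ, LinearMap.range (S.opG j θ x) :
    Submodule ℝ (TangentSpace (𝓡 n) x))

/-- The covector `⟨p, ∂ʲG/∂θʲ (θ, x)⟩ = (⟨p, ∂ʲG_i/∂θʲ (θ, x)⟩)_i`, with the Euclidean norm. -/
def System.pair (S : System n m M) (j : ℕ) (θ : ℝ) (x : M) (p : TangentSpace (𝓡 n) x →L[ℝ] ℝ) :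
    EuclideanSpace ℝ (Fin m) :=
  WithLp.toLp 2 (fun i => p (S.dG j θ i x))

/-- The Hamiltonian `H(x, p) = (1/2π) ∫₀^{2π} ‖⟨p, G(θ, x)⟩‖ dθ` on the cotangent bundle. -/
def System.H (S : System n m M) (x : M) (p : TangentSpace (𝓡 n) x →L[ℝ] ℝ) : ℝ :=
  (1 / (2 * Real.pi)) * ∫ θ in (0 : ℝ)..(2 * Real.pi), ‖S.pair 0 θ x p‖

/-- The space `ℝ^{2n} = ℝ^n × (ℝ^n)*` of the coordinates `(x, p)`, with the Euclidean norm. -/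
abbrev Coord (n : ℕ) : Type :=
  WithLp 2 (EuclideanSpace ℝ (Fin n) × (EuclideanSpace ℝ (Fin n) →L[ℝ] ℝ))

/-- The coordinates on `T*M` of the point `(x, p)`, induced by the chart `e` of `M`:
the first component is `e x`, the second one is `p ∘ (de_x)⁻¹`. -/
def coordOf (e : OpenPartialHomeomorph M (EuclideanSpace ℝ (Fin n)))
    (x : M) (p : TangentSpace (𝓡 n) x →L[ℝ] ℝ) : Coord n :=
  WithLp.toLp 2
    (e x, p ∘L (mfderiv (𝓡 n) 𝓘(ℝ, EuclideanSpace ℝ (Fin n)) e x).inverse)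

/-- The Hamiltonian in the coordinates of `T*M` induced by the chart `e` of `M`: the coordinates
`(y, q)`, `y ∈ e.target`, stand for the point `x = e⁻¹(y)` and the covector `p = q ∘ de_x`. -/
def System.HCoord (S : System n m M) (e : OpenPartialHomeomorph M (EuclideanSpace ℝ (Fin n)))
    (X : Coord n) : ℝ :=
  S.H (e.symm X.fst)
    (X.snd ∘L (mfderiv (𝓡 n) 𝓘(ℝ, EuclideanSpace ℝ (Fin n)) e (e.symm X.fst) :
      TangentSpace (𝓡 n) (e.symm X.fst) →L[ℝ] EuclideanSpace ℝ (Fin n)))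

end

/-- The average `𝖧(X) = (1/2π) ∫₀^{2π} ‖V(θ, X)‖ dθ`. -/
def avgNorm {d m : ℕ} (V : ℝ → EuclideanSpace ℝ (Fin d) → EuclideanSpace ℝ (Fin m))
    (X : EuclideanSpace ℝ (Fin d)) : ℝ :=
  (1 / (2 * Real.pi)) * ∫ θ in (0 : ℝ)..(2 * Real.pi), ‖V θ X‖

/-- `V : S¹ × Ω → ℝ^m` is a smooth map. -/
def SmoothOnCircle {d m : ℕ} (Ω : Set (EuclideanSpace ℝ (Fin d)))
    (V : ℝ → EuclideanSpace ℝ (Fin d) → EuclideanSpace ℝ (Fin m)) : Prop :=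
  ContDiffOn ℝ ∞ (fun z : ℝ × EuclideanSpace ℝ (Fin d) => V z.1 z.2) (Set.univ ×ˢ Ω) ∧
    ∀ θ, ∀ X ∈ Ω, V (θ + 2 * Real.pi) X = V θ X

/-- `f` is continuously differentiable on the open set `U` and its derivative has modulus of
continuity `c δ ln (1/δ)` there. -/
def LogLipDerivOn {E : Type*} [NormedAddCommGroup E] [NormedSpace ℝ E]
    (f : E → ℝ) (c : ℝ) (U : Set E) : Prop :=
  ContDiffOn ℝ 1 f U ∧
    ∀ X ∈ U, ∀ Y ∈ U, ‖fderiv ℝ f X - fderiv ℝ f Y‖ ≤ c * ‖X - Y‖ * Real.log (1 / ‖X - Y‖)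

end FastOsc

end

/-! Differentiating under the integral gives the average over θ of `A(θ,X)ᵀ u(V(θ,X))`, where `A =
∂V/∂X` and `u(v) = v/‖v‖`. The integrand is bounded by `‖A‖` and continuous in X wherever V does not
vanish, so a null set of zeros is enough for C¹.

For the modulus, let `ρ = ‖X - Y‖`. The variation of A costs O(ρ), and that of u is at most
`4t/(‖V(θ,X)‖ + t)` with `t = Lρ` (`norm_unit_sub_unit_le`). A simple zero yields `‖V(θ,X)‖ ≥ c|θ -
τ|` with c uniform in X and τ depending on X (`exists_eventually_mul_abs_sub_le`), and `∫ t/(c|θ -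
τ| + t) dθ = O(ρ ln(1/ρ))`: this is the source of the logarithm.

The point τ need not be a zero of `V(·,X)`, since the zero may disappear under perturbation. It is
found by projecting V onto `w = ∂V/∂θ` at the zero: `⟨w,V⟩` is a scalar function, strictly
increasing in θ, uniformly for nearby X. Thus no condition on `∂V/∂X` enters.

The Hamiltonian is the case `V = ⟨p, G⟩` read in a chart, on the open set of nonzero covectors. -/

namespace FastOsc

/-! ### Normalization of vectors and the derivative of the norm -/

section UnitVector

variable {F : Type*} [NormedAddCommGroup F] [InnerProductSpace ℝ F]

lemma norm_inv_norm_smul_le (v : F) : ‖‖v‖⁻¹ • v‖ ≤ 1 := by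
  rw [norm_smul, norm_inv, norm_norm]
  exact inv_mul_le_one

/-- The modulus of continuity of `v ↦ v / ‖v‖`, including at the origin. -/
lemma norm_unit_sub_unit_le (v w : F) {t : ℝ} (ht : ‖v - w‖ ≤ t) :
    (‖v‖ + t) * ‖‖v‖⁻¹ • v - ‖w‖⁻¹ • w‖ ≤ 4 * t := by
  -- Holds at 0 as well, because the normalized zero vector is 0; no case split on v and w is then
  -- needed.
  have key : ∀ u : F, ‖u‖ • (‖u‖⁻¹ • u) = u := fun u => by
    rcases eq_or_ne u 0 with rfl | hu
    · simp
    · rw [smul_smul, mul_inv_cancel₀ (norm_ne_zero_iff.2 hu), one_smul]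
  have h0 : 0 ≤ t := (norm_nonneg _).trans ht
  have h1 : ‖‖v‖⁻¹ • v - ‖w‖⁻¹ • w‖ ≤ 2 :=
    (norm_sub_le _ _).trans (by linarith [norm_inv_norm_smul_le v, norm_inv_norm_smul_le w])
  have h2 : ‖v‖ * ‖‖v‖⁻¹ • v - ‖w‖⁻¹ • w‖ ≤ 2 * t := by
    have e : ‖v‖ • (‖v‖⁻¹ • v - ‖w‖⁻¹ • w) = (v - w) + (‖w‖ - ‖v‖) • (‖w‖⁻¹ • w) := by
      rw [smul_sub, sub_smul, key, key]; abel
    calc ‖v‖ * ‖‖v‖⁻¹ • v - ‖w‖⁻¹ • w‖ = ‖‖v‖ • (‖v‖⁻¹ • v - ‖w‖⁻¹ • w)‖ := by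
          rw [norm_smul, norm_norm]
      _ ≤ ‖v - w‖ + |‖w‖ - ‖v‖| * 1 := by
          rw [e]
          refine (norm_add_le _ _).trans ?_
          rw [norm_smul, Real.norm_eq_abs]
          gcongr
          exact norm_inv_norm_smul_le w
      _ ≤ 2 * t := by
          have := abs_norm_sub_norm_le w v
          rw [norm_sub_rev] at this
          linarith
  nlinarith

lemma hasFDerivAt_norm {v : F} (hv : v ≠ 0) :
    HasFDerivAt (fun u : F => ‖u‖) (innerSL ℝ (‖v‖⁻¹ • v)) v := by
  have h := ((hasStrictFDerivAt_norm_sq v).hasFDerivAt).sqrt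
    (pow_ne_zero 2 (norm_ne_zero_iff.2 hv))
  simp only [Real.sqrt_sq (norm_nonneg _)] at h
  refine h.congr_fderiv ?_
  ext u
  simp
  field_simp

end UnitVector

/-! ### Maps depending on a parameter: uniform bounds on compact sets -/

section Param

section Topological

variable {E W : Type*} [TopologicalSpace E] [TopologicalSpace W] {Ω : Set E} {V : ℝ → E → W}

lemma continuous_left_of_prod
    (hV : ContinuousOn (fun z : ℝ × E => V z.1 z.2) (Set.univ ×ˢ Ω)) {X : E} (hX : X ∈ Ω) :
    Continuous (fun θ => V θ X) :=
  hV.comp_continuous (by fun_prop : Continuous fun θ : ℝ => (θ, X)) fun _ => ⟨trivial, hX⟩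

lemma continuousAt_of_prod (hΩ : IsOpen Ω)
    (hV : ContinuousOn (fun z : ℝ × E => V z.1 z.2) (Set.univ ×ˢ Ω)) {X : E} (hX : X ∈ Ω)
    (θ : ℝ) : ContinuousAt (fun z : ℝ × E => V z.1 z.2) (θ, X) :=
  hV.continuousAt ((isOpen_univ.prod hΩ).mem_nhds ⟨trivial, hX⟩)

end Topological

lemma exists_eventually_bound_of_prod {E W : Type*} [TopologicalSpace E]
    [NormedAddCommGroup W] {Ω : Set E} {V : ℝ → E → W} (hΩ : IsOpen Ω)
    (hV : ContinuousOn (fun z : ℝ × E => V z.1 z.2) (Set.univ ×ˢ Ω)) {X : E} (hX : X ∈ Ω)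
    {K : Set ℝ} (hK : IsCompact K) :
    ∃ C > 0, ∀ᶠ Y in 𝓝 X, ∀ θ ∈ K, ‖V θ Y‖ ≤ C := by
  obtain ⟨C, hC⟩ := hK.exists_bound_of_continuousOn (continuous_left_of_prod hV hX).continuousOn
  -- The added 1 makes the bound strict at X, hence stable nearby; `max` with 0 covers an empty K,
  -- where C may be negative.
  refine ⟨max C 0 + 1, by positivity, ?_⟩
  refine hK.eventually_forall_of_forall_eventually fun θ hθ => ?_
  have hc : ContinuousAt (fun z : E × ℝ => ‖V z.2 z.1‖) (X, θ) :=
    ((continuousAt_of_prod hΩ hV hX θ).norm.comp (f := fun z : E × ℝ => (z.2, z.1))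
      (x := (X, θ)) (by fun_prop))
  have : ‖V θ X‖ < max C 0 + 1 := (hC θ hθ).trans_lt (by linarith [le_max_left C 0])
  exact (hc.eventually (gt_mem_nhds this)).mono fun z hz => le_of_lt hz


variable {E W : Type*} [NormedAddCommGroup E] [NormedSpace ℝ E]
  [NormedAddCommGroup W] [NormedSpace ℝ W] {Ω : Set E} {V : ℝ → E → W}

lemma contDiffAt_of_prod {k : WithTop ℕ∞} (hΩ : IsOpen Ω)
    (hV : ContDiffOn ℝ k (fun z : ℝ × E => V z.1 z.2) (Set.univ ×ˢ Ω)) {X : E} (hX : X ∈ Ω)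
    (θ : ℝ) : ContDiffAt ℝ k (fun z : ℝ × E => V z.1 z.2) (θ, X) :=
  hV.contDiffAt ((isOpen_univ.prod hΩ).mem_nhds ⟨trivial, hX⟩)

lemma hasFDerivAt_of_prod (hΩ : IsOpen Ω)
    (hV : ContDiffOn ℝ 1 (fun z : ℝ × E => V z.1 z.2) (Set.univ ×ˢ Ω)) {X : E} (hX : X ∈ Ω)
    (θ : ℝ) : HasFDerivAt (V θ)
      ((fderiv ℝ (fun z : ℝ × E => V z.1 z.2) (θ, X)).comp (ContinuousLinearMap.inr ℝ ℝ E)) X :=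
  ((contDiffAt_of_prod hΩ hV hX θ).differentiableAt one_ne_zero).hasFDerivAt.comp X
    (hasFDerivAt_prodMk_right θ X)

lemma hasDerivAt_of_prod (hΩ : IsOpen Ω)
    (hV : ContDiffOn ℝ 1 (fun z : ℝ × E => V z.1 z.2) (Set.univ ×ˢ Ω)) {X : E} (hX : X ∈ Ω)
    (θ : ℝ) : HasDerivAt (fun t => V t X)
      (fderiv ℝ (fun z : ℝ × E => V z.1 z.2) (θ, X) (1, 0)) θ := by
  have h := ((contDiffAt_of_prod hΩ hV hX θ).differentiableAt one_ne_zero).hasFDerivAt.comp θ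
    (hasFDerivAt_prodMk_left (𝕜 := ℝ) θ X)
  exact h.hasDerivAt.congr_deriv (by simp)

lemma contDiffOn_fderiv_of_prod {k l : WithTop ℕ∞} (hΩ : IsOpen Ω) (hkl : k + 1 ≤ l)
    (hV : ContDiffOn ℝ l (fun z : ℝ × E => V z.1 z.2) (Set.univ ×ˢ Ω)) :
    ContDiffOn ℝ k (fun z : ℝ × E => fderiv ℝ (V z.1) z.2) (Set.univ ×ˢ Ω) := by
  have h := hV.fderiv_of_isOpen (isOpen_univ.prod hΩ) hkl
  have h1 : ContDiffOn ℝ 1 (fun z : ℝ × E => V z.1 z.2) (Set.univ ×ˢ Ω) :=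
    hV.of_le (le_trans (by simp) hkl)
  refine (h.clm_comp (contDiffOn_const (c := ContinuousLinearMap.inr ℝ ℝ E))).congr ?_
  rintro ⟨θ, X⟩ ⟨-, hX⟩
  exact (hasFDerivAt_of_prod hΩ h1 hX θ).fderiv

/-- A `C¹` map is bounded and Lipschitz near a point, uniformly with respect to a parameter in a
compact set. -/
lemma exists_ball_bound_lipschitz (hΩ : IsOpen Ω)
    (hV : ContDiffOn ℝ 1 (fun z : ℝ × E => V z.1 z.2) (Set.univ ×ˢ Ω)) {X : E} (hX : X ∈ Ω)
    {K : Set ℝ} (hK : IsCompact K) :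
    ∃ C > 0, ∃ ε > 0, Metric.ball X ε ⊆ Ω ∧ ∀ θ ∈ K, ∀ Y ∈ Metric.ball X ε,
      ‖V θ Y‖ ≤ C ∧ ‖fderiv ℝ (V θ) Y‖ ≤ C ∧
        ∀ Z ∈ Metric.ball X ε, ‖V θ Y - V θ Z‖ ≤ C * ‖Y - Z‖ := by
  have hD := (contDiffOn_fderiv_of_prod (k := 0) hΩ (by simp) hV).continuousOn
  obtain ⟨C₁, hC₁, h₁⟩ := exists_eventually_bound_of_prod hΩ hV.continuousOn hX hK
  obtain ⟨C₂, hC₂, h₂⟩ := exists_eventually_bound_of_prod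
    (V := fun θ X => fderiv ℝ (V θ) X) hΩ hD hX hK
  obtain ⟨ε, hε, hb⟩ := Metric.eventually_nhds_iff_ball.1
    ((h₁.and h₂).and (hΩ.eventually_mem hX))
  refine ⟨max C₁ C₂, lt_max_of_lt_left hC₁, ε, hε, fun Y hY => (hb Y hY).2,
    fun θ hθ Y hY => ⟨((hb Y hY).1.1 θ hθ).trans (le_max_left _ _),
      ((hb Y hY).1.2 θ hθ).trans (le_max_right _ _), fun Z hZ => ?_⟩⟩
  exact (convex_ball X ε).norm_image_sub_le_of_norm_fderiv_le
    (fun x hx => (hasFDerivAt_of_prod hΩ hV (hb x hx).2 θ).differentiableAt)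
    (fun x hx => ((hb x hx).1.2 θ hθ).trans (le_max_right _ _)) hZ hY

end Param

/-! ### Differentiation under the integral sign -/

section Average

variable {E F : Type*} [NormedAddCommGroup E] [NormedSpace ℝ E]
  [NormedAddCommGroup F] [InnerProductSpace ℝ F] {Ω : Set E} {V : ℝ → E → F}

/-- The differential of `X ↦ ‖V(θ, X)‖` at points where `V` does not vanish, extended by `0`. -/
noncomputable def normDeriv (V : ℝ → E → F) (θ : ℝ) (X : E) : E →L[ℝ] ℝ :=
  (innerSL ℝ (‖V θ X‖⁻¹ • V θ X)).comp (fderiv ℝ (V θ) X)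

lemma normDeriv_apply (θ : ℝ) (X h : E) :
    normDeriv V θ X h = ⟪fderiv ℝ (V θ) X h, ‖V θ X‖⁻¹ • V θ X⟫ := by
  rw [real_inner_comm]; rfl

lemma norm_normDeriv_le (θ : ℝ) (X : E) : ‖normDeriv V θ X‖ ≤ ‖fderiv ℝ (V θ) X‖ := by
  refine (ContinuousLinearMap.opNorm_comp_le _ _).trans ?_
  rw [innerSL_apply_norm]
  exact mul_le_of_le_one_left (norm_nonneg _) (norm_inv_norm_smul_le _)

/-- Product-rule splitting: the variation of `∂V/∂X` is paired with a unit vector, and the variation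
of the unit vector with `∂V/∂X` at Y. Only the norm of V at X is bounded below, so V may vanish at
Y. -/
lemma norm_normDeriv_sub_le (θ : ℝ) (X Y : E) {L t c : ℝ}
    (hA : ‖fderiv ℝ (V θ) Y‖ ≤ L) (hAA : ‖fderiv ℝ (V θ) X - fderiv ℝ (V θ) Y‖ ≤ t)
    (hV : ‖V θ X - V θ Y‖ ≤ t) (ht : 0 < t) (hc0 : 0 ≤ c) (hc : c ≤ ‖V θ X‖) :
    ‖normDeriv V θ X - normDeriv V θ Y‖ ≤ t + 4 * t * L * (c + t)⁻¹ := by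
  have e : normDeriv V θ X - normDeriv V θ Y =
      (innerSL ℝ (‖V θ X‖⁻¹ • V θ X)).comp (fderiv ℝ (V θ) X - fderiv ℝ (V θ) Y) +
      (innerSL ℝ (‖V θ X‖⁻¹ • V θ X - ‖V θ Y‖⁻¹ • V θ Y)).comp (fderiv ℝ (V θ) Y) := by
    ext h
    simp only [normDeriv, _root_.sub_apply, _root_.add_apply,
      ContinuousLinearMap.comp_apply, innerSL_apply_apply, inner_sub_left, inner_sub_right]
    ring
  have hN := norm_unit_sub_unit_le _ _ hV
  have hN' : ‖‖V θ X‖⁻¹ • V θ X - ‖V θ Y‖⁻¹ • V θ Y‖ ≤ 4 * t * (c + t)⁻¹ := by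
    rw [← div_eq_mul_inv, le_div_iff₀ (by positivity), mul_comm]
    exact le_trans (by gcongr) hN
  have hL : 0 ≤ L := (norm_nonneg _).trans hA
  rw [e]
  refine (norm_add_le _ _).trans (add_le_add ?_ ?_)
  · refine (ContinuousLinearMap.opNorm_comp_le _ _).trans ?_
    rw [innerSL_apply_norm]
    exact (mul_le_of_le_one_left (norm_nonneg _) (norm_inv_norm_smul_le _)).trans hAA
  · refine (ContinuousLinearMap.opNorm_comp_le _ _).trans ?_
    rw [innerSL_apply_norm, mul_right_comm]
    gcongr

lemma hasFDerivAt_norm_comp {θ : ℝ} {X : E} (hd : DifferentiableAt ℝ (V θ) X)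
    (h0 : V θ X ≠ 0) : HasFDerivAt (fun Y => ‖V θ Y‖) (normDeriv V θ X) X :=
  (hasFDerivAt_norm h0).comp X hd.hasFDerivAt

variable (hΩ : IsOpen Ω) (hV : ContDiffOn ℝ 1 (fun z : ℝ × E => V z.1 z.2) (Set.univ ×ˢ Ω))
include hΩ hV

/-- The unit vector may jump at zeros of V, so continuity is replaced by measurability of the
inverse norm. -/
lemma aestronglyMeasurable_normDeriv {X : E} (hX : X ∈ Ω) (μ : Measure ℝ) :
    AEStronglyMeasurable (fun θ => normDeriv V θ X) μ := by
  have hD := (contDiffOn_fderiv_of_prod (k := 0) hΩ (by simp) hV).continuousOn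
  have h1 : StronglyMeasurable fun θ => V θ X :=
    (continuous_left_of_prod hV.continuousOn hX).stronglyMeasurable
  have h2 : StronglyMeasurable fun θ => fderiv ℝ (V θ) X :=
    (continuous_left_of_prod (V := fun θ X => fderiv ℝ (V θ) X) hD hX).stronglyMeasurable
  have h3 : StronglyMeasurable fun θ => innerSL ℝ (‖V θ X‖⁻¹ • V θ X) :=
    (innerSL ℝ (E := F)).continuous.comp_stronglyMeasurable
      (h1.norm.measurable.inv.stronglyMeasurable.smul h1)
  have hc : Continuous fun p : (F →L[ℝ] ℝ) × (E →L[ℝ] F) => p.1.comp p.2 := by fun_prop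
  exact (hc.comp_stronglyMeasurable (h3.prodMk h2)).aestronglyMeasurable

lemma intervalIntegrable_normDeriv {X : E} (hX : X ∈ Ω) (a b : ℝ) :
    IntervalIntegrable (fun θ => normDeriv V θ X) volume a b := by
  have hD := (contDiffOn_fderiv_of_prod (k := 0) hΩ (by simp) hV).continuousOn
  have h2 : Continuous fun θ => fderiv ℝ (V θ) X :=
    continuous_left_of_prod (V := fun θ X => fderiv ℝ (V θ) X) hD hX
  exact (h2.intervalIntegrable a b).mono_fun (aestronglyMeasurable_normDeriv hΩ hV hX _)
    (Filter.Eventually.of_forall fun θ => norm_normDeriv_le θ X)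

/-- The Lipschitz form of dominated differentiation is the right one: zeros move with Y, so for a
given θ the norm may fail to be differentiable arbitrarily near X, while differentiability at X
itself holds for almost every θ. -/
lemma hasFDerivAt_integral_norm {X : E} (hX : X ∈ Ω) {a b : ℝ}
    (h0 : ∀ᵐ θ : ℝ, θ ∈ Set.uIoc a b → V θ X ≠ 0) :
    HasFDerivAt (fun Y => ∫ θ in a..b, ‖V θ Y‖) (∫ θ in a..b, normDeriv V θ X) X := by
  obtain ⟨C, hC, ε, hε, hbΩ, hb⟩ := exists_ball_bound_lipschitz hΩ hV hX
    (isCompact_uIcc (a := a) (b := b))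
  have hcont : ∀ Y ∈ Ω, Continuous fun θ => ‖V θ Y‖ := fun Y hY =>
    (continuous_left_of_prod hV.continuousOn hY).norm
  refine (intervalIntegral.hasFDerivAt_integral_of_dominated_loc_of_lip
    (s := Metric.ball X ε) (bound := fun _ => C) (Metric.ball_mem_nhds X hε)
    ?_ ((hcont X hX).intervalIntegrable a b) (aestronglyMeasurable_normDeriv hΩ hV hX _)
    (Filter.Eventually.of_forall fun θ hθ => ?_) intervalIntegrable_const ?_).2
  · filter_upwards [hΩ.mem_nhds hX] with Y hY using (hcont Y hY).aestronglyMeasurable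
  · refine LipschitzOnWith.of_dist_le_mul fun Y hY Z hZ => ?_
    rw [Real.coe_nnabs, abs_of_pos hC, dist_eq_norm, dist_eq_norm]
    exact (abs_norm_sub_norm_le _ _).trans
      ((hb θ (Set.uIoc_subset_uIcc hθ) Y hY).2.2 Z hZ)
  · filter_upwards [h0] with θ hθ hmem
    exact hasFDerivAt_norm_comp (hasFDerivAt_of_prod hΩ hV hX θ).differentiableAt (hθ hmem)

lemma continuousAt_integral_normDeriv {X : E} (hX : X ∈ Ω) {a b : ℝ}
    (h0 : ∀ᵐ θ : ℝ, θ ∈ Set.uIoc a b → V θ X ≠ 0) :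
    ContinuousAt (fun Y => ∫ θ in a..b, normDeriv V θ Y) X := by
  obtain ⟨C, hC, ε, hε, hbΩ, hb⟩ := exists_ball_bound_lipschitz hΩ hV hX
    (isCompact_uIcc (a := a) (b := b))
  have hD := (contDiffOn_fderiv_of_prod (k := 0) hΩ (by simp) hV).continuousOn
  have hincl : ∀ θ : ℝ, ContinuousAt (fun Y : E => (θ, Y)) X := fun θ =>
    (Continuous.prodMk continuous_const continuous_id).continuousAt
  refine intervalIntegral.continuousAt_of_dominated_interval (bound := fun _ => C) ?_ ?_
    intervalIntegrable_const ?_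
  · filter_upwards [hΩ.mem_nhds hX] with Y hY using aestronglyMeasurable_normDeriv hΩ hV hY _
  · filter_upwards [Metric.ball_mem_nhds X hε] with Y hY
    exact Filter.Eventually.of_forall fun θ hθ =>
      (norm_normDeriv_le θ Y).trans (hb θ (Set.uIoc_subset_uIcc hθ) Y hY).2.1
  · filter_upwards [h0] with θ hθ hmem
    have h1 : ContinuousAt (V θ) X :=
      (continuousAt_of_prod hΩ hV.continuousOn hX θ).comp (hincl θ)
    have h2 : ContinuousAt (fun Y => fderiv ℝ (V θ) Y) X :=
      (continuousAt_of_prod (V := fun θ X => fderiv ℝ (V θ) X) hΩ hD hX θ).comp (hincl θ)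
    have h3 : ContinuousAt (fun Y => ‖V θ Y‖⁻¹ • V θ Y) X :=
      (h1.norm.inv₀ (norm_ne_zero_iff.2 (hθ hmem))).smul h1
    exact ((innerSL ℝ (E := F)).continuous.continuousAt.comp h3).clm_comp h2

end Average

/-! ### Linear growth of the norm near a simple zero -/

section LowerBound

/-- Either f has a zero, taken as τ, or it keeps a sign and τ is the endpoint towards which `|f|`
decreases. -/
lemma exists_mul_abs_sub_le {f : ℝ → ℝ} {l r c : ℝ} (hlr : l ≤ r)
    (hf : ContinuousOn f (Set.Icc l r))
    (hmono : ∀ x ∈ Set.Icc l r, ∀ y ∈ Set.Icc l r, x ≤ y → c * (y - x) ≤ f y - f x) :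
    ∃ τ ∈ Set.Icc l r, ∀ x ∈ Set.Icc l r, c * |x - τ| ≤ |f x| := by
  have hl : l ∈ Set.Icc l r := ⟨le_rfl, hlr⟩
  have hr : r ∈ Set.Icc l r := ⟨hlr, le_rfl⟩
  rcases le_or_gt 0 (f l) with h | h
  · refine ⟨l, hl, fun x hx => ?_⟩
    rw [abs_of_nonneg (sub_nonneg.2 hx.1)]
    exact le_trans (by linarith [hmono l hl x hx hx.1]) (le_abs_self _)
  rcases le_or_gt (f r) 0 with h' | h'
  · refine ⟨r, hr, fun x hx => ?_⟩
    rw [abs_of_nonpos (sub_nonpos.2 hx.2)]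
    exact le_trans (by linarith [hmono x hx r hr hx.2]) (neg_le_abs _)
  obtain ⟨τ, hτ, h0⟩ := intermediate_value_Icc hlr hf ⟨h.le, h'.le⟩
  refine ⟨τ, hτ, fun x hx => ?_⟩
  rcases le_total τ x with hx' | hx'
  · rw [abs_of_nonneg (sub_nonneg.2 hx')]
    exact le_trans (by linarith [hmono τ hτ x hx hx']) (le_abs_self _)
  · rw [abs_of_nonpos (sub_nonpos.2 hx')]
    exact le_trans (by linarith [hmono x hx τ hτ hx']) (neg_le_abs _)

lemma exists_eventually_le_norm_of_prod {E W : Type*} [TopologicalSpace E]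
    [NormedAddCommGroup W] {Ω : Set E} {V : ℝ → E → W} (hΩ : IsOpen Ω)
    (hV : ContinuousOn (fun z : ℝ × E => V z.1 z.2) (Set.univ ×ˢ Ω)) {X : E} (hX : X ∈ Ω)
    {K : Set ℝ} (hK : IsCompact K) (h0 : ∀ θ ∈ K, V θ X ≠ 0) :
    ∃ c > 0, ∀ᶠ Y in 𝓝 X, ∀ θ ∈ K, c ≤ ‖V θ Y‖ := by
  obtain ⟨c, hc, hcK⟩ := hK.exists_forall_le' (a := 0)
    (continuous_left_of_prod hV hX).norm.continuousOn fun θ hθ => norm_pos_iff.2 (h0 θ hθ)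
  refine ⟨c / 2, half_pos hc, hK.eventually_forall_of_forall_eventually fun θ hθ => ?_⟩
  have hcont : ContinuousAt (fun z : E × ℝ => ‖V z.2 z.1‖) (X, θ) :=
    ((continuousAt_of_prod hΩ hV hX θ).norm.comp (f := fun z : E × ℝ => (z.2, z.1))
      (x := (X, θ)) (by fun_prop))
  have : c / 2 < ‖V θ X‖ := (half_lt_self hc).trans_le (hcK θ hθ)
  exact (hcont.eventually (lt_mem_nhds this)).mono fun z hz => le_of_lt hz

variable {E F : Type*} [NormedAddCommGroup E] [NormedSpace ℝ E]
  [NormedAddCommGroup F] [InnerProductSpace ℝ F] {Ω : Set E} {V : ℝ → E → F}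

/-- Near a simple zero `θ₀` of `V(·, X)`, the norm of `V(·, Y)` grows linearly from some point. -/
lemma exists_eventually_mul_abs_sub_le_of_deriv_ne_zero (hΩ : IsOpen Ω)
    (hV : ContDiffOn ℝ 1 (fun z : ℝ × E => V z.1 z.2) (Set.univ ×ˢ Ω)) {X : E} (hX : X ∈ Ω)
    {θ₀ R : ℝ} (hR : 0 < R) (h : deriv (fun t => V t X) θ₀ ≠ 0) :
    ∃ c > 0, ∃ δ > 0, δ ≤ R ∧ ∀ᶠ Y in 𝓝 X, ∃ τ ∈ Set.Icc (θ₀ - δ) (θ₀ + δ),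
      ∀ θ ∈ Set.Icc (θ₀ - δ) (θ₀ + δ), c * |θ - τ| ≤ ‖V θ Y‖ := by
  set w := deriv (fun t => V t X) θ₀ with hw
  have hwpos : 0 < ‖w‖ := norm_pos_iff.2 h
  set D : ℝ × E → F := fun z => fderiv ℝ (fun z : ℝ × E => V z.1 z.2) z (1, 0) with hD
  have hwD : w = D (θ₀, X) := (hasDerivAt_of_prod hΩ hV hX θ₀).deriv
  have hDc : ContinuousAt D (θ₀, X) :=
    ((hV.continuousOn_fderiv_of_isOpen (isOpen_univ.prod hΩ) le_rfl).continuousAt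
      ((isOpen_univ.prod hΩ).mem_nhds ⟨trivial, hX⟩)).clm_apply continuousAt_const
  -- Half of `⟨w, w⟩` leaves room for perturbation: `⟨w, V⟩` then has θ-slope above `‖w‖²/2`
  -- throughout a neighborhood of `(θ₀, X)`.
  have hlt : ‖w‖ ^ 2 / 2 < ⟪w, D (θ₀, X)⟫ := by
    rw [← hwD, real_inner_self_eq_norm_sq]
    have := pow_pos hwpos 2
    linarith
  have hev : ∀ᶠ z in 𝓝 (θ₀, X), ‖w‖ ^ 2 / 2 < ⟪w, D z⟫ :=
    (continuousAt_const.inner hDc).eventually (lt_mem_nhds hlt)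
  rw [nhds_prod_eq, Filter.eventually_prod_iff] at hev
  obtain ⟨p, hp, q, hq, hpq⟩ := hev
  obtain ⟨δ', hδ', hball⟩ := Metric.eventually_nhds_iff.1 hp
  refine ⟨‖w‖ / 2, half_pos hwpos, min (δ' / 2) R, lt_min (half_pos hδ') hR, min_le_right _ _, ?_⟩
  set δ := min (δ' / 2) R with hδ
  have hδ0 : 0 < δ := lt_min (half_pos hδ') hR
  have hδl : δ < δ' := (min_le_left _ _).trans_lt (half_lt_self hδ')
  filter_upwards [hq, hΩ.mem_nhds hX] with Y hY hYΩ
  have hder : ∀ θ, HasDerivAt (fun t => ⟪w, V t Y⟫) ⟪w, D (θ, Y)⟫ θ := fun θ => by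
    simpa using (hasDerivAt_const θ w).inner ℝ (hasDerivAt_of_prod hΩ hV hYΩ θ)
  have hdiff : Differentiable ℝ (fun t => ⟪w, V t Y⟫) := fun θ => (hder θ).differentiableAt
  obtain ⟨τ, hτ, hτle⟩ := exists_mul_abs_sub_le (f := fun t => ⟪w, V t Y⟫)
    (l := θ₀ - δ) (r := θ₀ + δ) (c := ‖w‖ ^ 2 / 2)
    (by linarith) hdiff.continuous.continuousOn (fun x hx y hy hxy =>
      (convex_Icc (θ₀ - δ) (θ₀ + δ)).mul_sub_le_image_sub_of_le_deriv
        hdiff.continuous.continuousOn hdiff.differentiableOn (fun θ hθ => by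
          rw [(hder θ).deriv]
          refine (hpq (hball ?_) hY).le
          have := interior_subset hθ
          rw [Real.dist_eq, abs_lt]
          constructor <;> linarith [this.1, this.2]) x hx y hy hxy)
  refine ⟨τ, hτ, fun θ hθ => ?_⟩
  -- Cauchy–Schwarz: dividing by `‖w‖` turns the slope `‖w‖²/2` into the constant `‖w‖/2`.
  have h1 := (hτle θ hθ).trans (abs_real_inner_le_norm w (V θ Y))
  refine le_of_mul_le_mul_left (le_trans (le_of_eq ?_) h1) hwpos
  ring

/-- If `V(·, X)` has at most one zero modulo `2π`, which is simple, then on an interval of length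
`2π` the norm of `V(·, Y)` grows linearly from some point, uniformly for `Y` near `X`. -/
lemma exists_eventually_mul_abs_sub_le (hΩ : IsOpen Ω)
    (hV : ContDiffOn ℝ 1 (fun z : ℝ × E => V z.1 z.2) (Set.univ ×ˢ Ω)) {X : E} (hX : X ∈ Ω)
    (h1 : ∀ θ θ' : ℝ, V θ X = 0 → V θ' X = 0 → (θ : Real.Angle) = (θ' : Real.Angle))
    (h2 : ∀ θ : ℝ, V θ X = 0 → deriv (fun t => V t X) θ ≠ 0) :
    ∃ c > 0, c ≤ 1 ∧ ∃ a : ℝ, ∀ᶠ Y in 𝓝 X, ∃ τ ∈ Set.Icc a (a + 2 * Real.pi),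
      ∀ θ ∈ Set.Icc a (a + 2 * Real.pi), c * |θ - τ| ≤ ‖V θ Y‖ := by
  have hpi := Real.pi_pos
  -- Away from the zero, a constant lower bound is also a linear one, as `|θ - τ|` is at most 2π.
  have hfar : ∀ {a c θ τ : ℝ}, 0 < c → τ ∈ Set.Icc a (a + 2 * Real.pi) →
      θ ∈ Set.Icc a (a + 2 * Real.pi) → c / (2 * Real.pi) * |θ - τ| ≤ c := by
    intro a c θ τ hc hτ hθ
    have : |θ - τ| ≤ 2 * Real.pi := by
      rw [abs_le]
      constructor <;> linarith [hτ.1, hτ.2, hθ.1, hθ.2]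
    calc c / (2 * Real.pi) * |θ - τ| ≤ c / (2 * Real.pi) * (2 * Real.pi) := by gcongr
      _ = c := by field_simp
  by_cases hz : ∃ θ₀, V θ₀ X = 0
  · obtain ⟨θ₀, hθ₀⟩ := hz
    obtain ⟨c₁, hc₁, δ, hδ, hδpi, hnear⟩ :=
      exists_eventually_mul_abs_sub_le_of_deriv_ne_zero hΩ hV hX hpi (h2 θ₀ hθ₀)
    have hIcc : θ₀ - Real.pi + 2 * Real.pi = θ₀ + Real.pi := by ring
    obtain ⟨c₂, hc₂, hout⟩ := exists_eventually_le_norm_of_prod hΩ hV.continuousOn hX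
      (K := Set.Icc (θ₀ - Real.pi) (θ₀ + Real.pi) \ Set.Ioo (θ₀ - δ) (θ₀ + δ))
      (isCompact_Icc.diff isOpen_Ioo) (by
        rintro θ ⟨⟨hl, hr⟩, hne⟩ hθ
        -- Two zeros differ by `2πk`, and `|θ - θ₀| ≤ π` forces `k = 0`; hence the window centred at
        -- θ₀.
        obtain ⟨k, hk⟩ := Real.Angle.angle_eq_iff_two_pi_dvd_sub.1 (h1 θ θ₀ hθ hθ₀)
        have hk1 : (k : ℝ) < 1 := by
          by_contra! hk'
          nlinarith
        have hk2 : (-1 : ℝ) < k := by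
          by_contra! hk'
          nlinarith
        have hk0 : k = 0 := by
          have hk1' : k < 1 := by exact_mod_cast hk1
          have hk2' : -1 < k := by exact_mod_cast hk2
          omega
        rw [hk0, Int.cast_zero, mul_zero, sub_eq_zero] at hk
        exact hne ⟨by linarith, by linarith⟩)
    refine ⟨min (min c₁ (c₂ / (2 * Real.pi))) 1,
      lt_min (lt_min hc₁ (div_pos hc₂ (by positivity))) one_pos, min_le_right _ _,
      θ₀ - Real.pi, ?_⟩
    filter_upwards [hnear, hout] with Y ⟨τ, hτ, hle⟩ hY
    have hτ' : τ ∈ Set.Icc (θ₀ - Real.pi) (θ₀ - Real.pi + 2 * Real.pi) :=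
      ⟨by linarith [hτ.1], by linarith [hτ.2]⟩
    refine ⟨τ, hτ', fun θ hθ => ?_⟩
    by_cases hin : θ ∈ Set.Ioo (θ₀ - δ) (θ₀ + δ)
    · refine le_trans ?_ (hle θ (Set.Ioo_subset_Icc_self hin))
      gcongr
      exact (min_le_left _ _).trans (min_le_left _ _)
    · refine le_trans ?_ (hY θ ⟨hIcc ▸ hθ, hin⟩)
      refine le_trans ?_ (hfar hc₂ hτ' hθ)
      gcongr
      exact (min_le_left _ _).trans (min_le_right _ _)
  · push Not at hz
    obtain ⟨c, hc, hev⟩ := exists_eventually_le_norm_of_prod hΩ hV.continuousOn hX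
      (isCompact_Icc (a := 0) (b := 0 + 2 * Real.pi)) fun θ _ => hz θ
    refine ⟨min (c / (2 * Real.pi)) 1, lt_min (div_pos hc (by positivity)) one_pos,
      min_le_right _ _, 0, hev.mono fun Y hY => ?_⟩
    have h0 : (0 : ℝ) ∈ Set.Icc 0 (0 + 2 * Real.pi) := ⟨le_rfl, by linarith⟩
    refine ⟨0, h0, fun θ hθ => le_trans ?_ (hY θ hθ)⟩
    refine le_trans ?_ (hfar hc h0 hθ)
    gcongr
    exact min_le_left _ _

end LowerBound

/-! ### The integral that produces the logarithm -/

section LogIntegral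

lemma intervalIntegrable_inv_mul_abs_add {c t : ℝ} (hc : 0 ≤ c) (ht : 0 < t) (τ a b : ℝ) :
    IntervalIntegrable (fun θ => (c * |θ - τ| + t)⁻¹) volume a b := by
  refine Continuous.intervalIntegrable (Continuous.inv₀ (by fun_prop) fun θ => ?_) a b
  positivity

/-- Splitting at τ removes the absolute value; each half integrates to a logarithm and is bounded by
its value for the full length `b - a`. -/
lemma integral_inv_mul_abs_add_le {a b c t τ : ℝ} (hc : 0 < c) (ht : 0 < t)
    (hτ : τ ∈ Set.Icc a b) :
    ∫ θ in a..b, (c * |θ - τ| + t)⁻¹ ≤ 2 / c * Real.log ((c * (b - a) + t) / t) := by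
  have hint := intervalIntegrable_inv_mul_abs_add hc.le ht τ
  have hlog : ∀ x, 0 ≤ x → x ≤ b - a →
      c⁻¹ * Real.log (c * x + t) - c⁻¹ * Real.log t ≤
        1 / c * Real.log ((c * (b - a) + t) / t) := fun x hx hxb => by
    rw [← mul_sub, one_div, ← Real.log_div (by positivity) ht.ne']
    gcongr
  have h1 : ∫ θ in τ..b, (c * |θ - τ| + t)⁻¹ =
      c⁻¹ * Real.log (c * (b - τ) + t) - c⁻¹ * Real.log t := by
    rw [intervalIntegral.integral_eq_sub_of_hasDerivAt
      (f := fun θ => c⁻¹ * Real.log (c * (θ - τ) + t)) ?_ (hint τ b)]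
    · simp
    · intro θ hθ
      rw [Set.uIcc_of_le hτ.2] at hθ
      have h0 : 0 ≤ θ - τ := sub_nonneg.2 hθ.1
      rw [abs_of_nonneg h0]
      have hpos : c * (θ - τ) + t ≠ 0 := by positivity
      have := ((((hasDerivAt_id θ).sub_const τ).const_mul c).add_const t).log hpos
      refine (this.const_mul c⁻¹).congr_deriv ?_
      simp only [id, mul_one]
      field_simp
  have h2 : ∫ θ in a..τ, (c * |θ - τ| + t)⁻¹ =
      c⁻¹ * Real.log (c * (τ - a) + t) - c⁻¹ * Real.log t := by
    rw [intervalIntegral.integral_eq_sub_of_hasDerivAt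
      (f := fun θ => -(c⁻¹ * Real.log (c * (τ - θ) + t))) ?_ (hint a τ)]
    · simp
      ring
    · intro θ hθ
      rw [Set.uIcc_of_le hτ.1] at hθ
      have h0 : 0 ≤ τ - θ := sub_nonneg.2 hθ.2
      rw [abs_sub_comm, abs_of_nonneg h0]
      have hpos : c * (τ - θ) + t ≠ 0 := by positivity
      have := ((((hasDerivAt_id θ).const_sub τ).const_mul c).add_const t).log hpos
      refine (this.const_mul c⁻¹).neg.congr_deriv ?_
      simp only [id]
      field_simp
  rw [← intervalIntegral.integral_add_adjacent_intervals (hint a τ) (hint τ b), h1, h2]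
  have e1 := hlog (b - τ) (by linarith [hτ.2]) (by linarith [hτ.1])
  have e2 := hlog (τ - a) (by linarith [hτ.1]) (by linarith [hτ.2])
  calc _ ≤ 1 / c * Real.log ((c * (b - a) + t) / t) + 1 / c * Real.log ((c * (b - a) + t) / t) :=
        add_le_add e2 e1
    _ = _ := by ring

lemma one_le_log_inv {ρ : ℝ} (hρ : 0 < ρ) (hρ' : ρ ≤ 1 / 8) : 1 ≤ Real.log (1 / ρ) := by
  rw [Real.le_log_iff_exp_le (by positivity)]
  have : 8 ≤ 1 / ρ := by rw [le_div_iff₀ hρ]; linarith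
  linarith [Real.exp_one_lt_d9]

/-- The quotient is at most `ρ⁻²`, since `(2πc + Lρ)ρ ≤ L`: the threshold 1/8 works because `2π/8 <
1` with enough margin for `L/64`. -/
lemma log_add_div_le {c L ρ : ℝ} (hc : 0 < c) (hc1 : c ≤ 1) (hL : 1 ≤ L) (hρ : 0 < ρ)
    (hρ' : ρ ≤ 1 / 8) :
    Real.log ((c * (2 * Real.pi) + L * ρ) / (L * ρ)) ≤ 2 * Real.log (1 / ρ) := by
  have hpi := Real.pi_pos
  have hpi' := Real.pi_lt_d2
  rw [show (2 : ℝ) * Real.log (1 / ρ) = Real.log ((1 / ρ) ^ 2) by rw [Real.log_pow]; norm_num]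
  refine Real.log_le_log (by positivity) ?_
  rw [div_pow, one_pow, div_le_div_iff₀ (by positivity) (by positivity)]
  have h1 : c * (2 * Real.pi) ≤ 6.3 := by nlinarith
  have h2 : (c * (2 * Real.pi) + L * ρ) * ρ ≤ L := by
    have h3 : c * (2 * Real.pi) * ρ ≤ 6.3 * (1 / 8) := by gcongr
    have h4 : L * ρ * ρ ≤ L * (1 / 8) * (1 / 8) := by gcongr
    linarith
  nlinarith

end LogIntegral

/-! ### The averaged norm and the modulus of continuity of its derivative -/

section MeanNorm

variable {E F : Type*} [NormedAddCommGroup E] [NormedSpace ℝ E]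
  [NormedAddCommGroup F] [InnerProductSpace ℝ F] {Ω : Set E} {V : ℝ → E → F}

/-- The average over a period of `‖V(θ, X)‖`. -/
noncomputable def meanNorm (V : ℝ → E → F) (X : E) : ℝ :=
  (1 / (2 * Real.pi)) * ∫ θ in (0 : ℝ)..(2 * Real.pi), ‖V θ X‖

lemma hasFDerivAt_meanNorm (hΩ : IsOpen Ω)
    (hV : ContDiffOn ℝ 1 (fun z : ℝ × E => V z.1 z.2) (Set.univ ×ˢ Ω)) {X : E} (hX : X ∈ Ω)
    (h0 : ∀ᵐ θ : ℝ, θ ∈ Set.uIoc 0 (2 * Real.pi) → V θ X ≠ 0) :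
    HasFDerivAt (meanNorm V)
      ((1 / (2 * Real.pi)) • ∫ θ in (0 : ℝ)..(2 * Real.pi), normDeriv V θ X) X :=
  (hasFDerivAt_integral_norm hΩ hV hX h0).const_mul _

lemma contDiffOn_meanNorm (hΩ : IsOpen Ω)
    (hV : ContDiffOn ℝ 1 (fun z : ℝ × E => V z.1 z.2) (Set.univ ×ˢ Ω))
    (h0 : ∀ X ∈ Ω, ∀ᵐ θ : ℝ, θ ∈ Set.uIoc 0 (2 * Real.pi) → V θ X ≠ 0) :
    ContDiffOn ℝ 1 (meanNorm V) Ω := by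
  have hd := fun X (hX : X ∈ Ω) => hasFDerivAt_meanNorm hΩ hV hX (h0 X hX)
  rw [show (1 : WithTop ℕ∞) = 0 + 1 by simp, contDiffOn_succ_iff_fderiv_of_isOpen hΩ]
  refine ⟨fun X hX => (hd X hX).differentiableAt.differentiableWithinAt, by simp, ?_⟩
  rw [contDiffOn_zero]
  have hc : ContinuousOn ((1 / (2 * Real.pi)) • fun X =>
      ∫ θ in (0 : ℝ)..(2 * Real.pi), normDeriv V θ X) Ω := fun X hX =>
    ((continuousAt_integral_normDeriv hΩ hV hX (h0 X hX)).const_smul _).continuousWithinAt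
  exact hc.congr fun X hX => (hd X hX).fderiv

/-- Allows the period of integration to be moved to the window adapted to the zero. -/
lemma periodic_normDeriv (hΩ : IsOpen Ω)
    (hper : ∀ θ, ∀ X ∈ Ω, V (θ + 2 * Real.pi) X = V θ X) {X : E} (hX : X ∈ Ω) :
    Function.Periodic (fun θ => normDeriv V θ X) (2 * Real.pi) := fun θ => by
  have h : V (θ + 2 * Real.pi) =ᶠ[𝓝 X] V θ := by
    filter_upwards [hΩ.mem_nhds hX] with Y hY using hper θ Y hY
  simp only [normDeriv, h.fderiv_eq, hper θ X hX]

/-- All zeros lie in a single coset of `2πℤ`, which is countable. -/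
lemma ae_ne_zero_of_angle_unique {W : Type*} [Zero W] {v : ℝ → W}
    (h : ∀ θ θ' : ℝ, v θ = 0 → v θ' = 0 → (θ : Real.Angle) = (θ' : Real.Angle)) :
    ∀ᵐ θ : ℝ, v θ ≠ 0 := by
  have hc : {θ | v θ = 0}.Countable := by
    rcases Set.eq_empty_or_nonempty {θ | v θ = 0} with he | ⟨θ₀, hθ₀⟩
    · simp [he]
    · refine (Set.countable_range fun k : ℤ => θ₀ + 2 * Real.pi * k).mono fun θ hθ => ?_
      obtain ⟨k, hk⟩ := Real.Angle.angle_eq_iff_two_pi_dvd_sub.1 (h θ θ₀ hθ hθ₀)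
      exact ⟨k, by simp only; linarith⟩
  exact measure_eq_zero_iff_ae_notMem.1 (hc.measure_zero volume)

/-- The integrand is at most `Lρ + 4L²ρ/(c|θ - τ| + Lρ)`. The first term is absorbed using `ln(1/ρ)
≥ 1`; in the second, `16 = 4 · 2 · 2` collects the factors from the unit vectors, the two sides of τ
and the exponent in `ρ⁻²`. -/
lemma norm_integral_normDeriv_sub_le (hΩ : IsOpen Ω)
    (hV : ContDiffOn ℝ 1 (fun z : ℝ × E => V z.1 z.2) (Set.univ ×ˢ Ω)) {X Y : E} (hX : X ∈ Ω)
    (hY : Y ∈ Ω) {a c L τ : ℝ} (hc : 0 < c) (hc1 : c ≤ 1) (hL : 1 ≤ L)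
    (hτ : τ ∈ Set.Icc a (a + 2 * Real.pi))
    (hle : ∀ θ ∈ Set.Icc a (a + 2 * Real.pi), c * |θ - τ| ≤ ‖V θ X‖)
    (hA : ∀ θ ∈ Set.Icc a (a + 2 * Real.pi), ‖fderiv ℝ (V θ) Y‖ ≤ L)
    (hAA : ∀ θ ∈ Set.Icc a (a + 2 * Real.pi),
      ‖fderiv ℝ (V θ) X - fderiv ℝ (V θ) Y‖ ≤ L * ‖X - Y‖)
    (hVV : ∀ θ ∈ Set.Icc a (a + 2 * Real.pi), ‖V θ X - V θ Y‖ ≤ L * ‖X - Y‖)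
    (hXY : X ≠ Y) (hρ : ‖X - Y‖ ≤ 1 / 8) :
    ‖(∫ θ in a..(a + 2 * Real.pi), normDeriv V θ X) -
      ∫ θ in a..(a + 2 * Real.pi), normDeriv V θ Y‖ ≤
      (2 * Real.pi * L + 16 * L ^ 2 / c) * ‖X - Y‖ * Real.log (1 / ‖X - Y‖) := by
  have hpi := Real.pi_pos
  set ρ := ‖X - Y‖ with hρdef
  have hρ0 : 0 < ρ := norm_pos_iff.2 (sub_ne_zero.2 hXY)
  have ht : 0 < L * ρ := by positivity
  have hab : a ≤ a + 2 * Real.pi := by linarith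
  have hint := intervalIntegrable_inv_mul_abs_add hc.le ht τ a (a + 2 * Real.pi)
  rw [← intervalIntegral.integral_sub (intervalIntegrable_normDeriv hΩ hV hX _ _)
    (intervalIntegrable_normDeriv hΩ hV hY _ _)]
  calc _ ≤ ∫ θ in a..(a + 2 * Real.pi), (L * ρ + 4 * (L * ρ) * L * (c * |θ - τ| + L * ρ)⁻¹) := by
        refine intervalIntegral.norm_integral_le_of_norm_le hab
          (Filter.Eventually.of_forall fun θ hθ => ?_)
          (intervalIntegrable_const.add (hint.const_mul _))
        have hθ' := Set.Ioc_subset_Icc_self hθ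
        exact norm_normDeriv_sub_le θ X Y (hA θ hθ') (hAA θ hθ') (hVV θ hθ') ht (by positivity)
          (hle θ hθ')
    _ = 2 * Real.pi * (L * ρ) + 4 * (L * ρ) * L *
          ∫ θ in a..(a + 2 * Real.pi), (c * |θ - τ| + L * ρ)⁻¹ := by
        rw [intervalIntegral.integral_add intervalIntegrable_const (hint.const_mul _),
          intervalIntegral.integral_const, intervalIntegral.integral_const_mul]
        simp
    _ ≤ 2 * Real.pi * (L * ρ) * Real.log (1 / ρ) + 4 * (L * ρ) * L *
          (2 / c * (2 * Real.log (1 / ρ))) := by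
        refine add_le_add (le_mul_of_one_le_right (by positivity) (one_le_log_inv hρ0 hρ)) ?_
        gcongr
        refine (integral_inv_mul_abs_add_le hc ht hτ).trans ?_
        gcongr
        rw [add_sub_cancel_left]
        exact log_add_div_le hc hc1 hL hρ0 hρ
    _ = _ := by ring

/-- Near any point, the derivative of the average of `‖V(θ, X)‖` has modulus of continuity
`δ ln (1/δ)` if `V(·, X)` has at most one zero modulo `2π` and this zero is simple. -/
theorem exists_logLipDerivOn_meanNorm (hΩ : IsOpen Ω)
    (hV : ContDiffOn ℝ 2 (fun z : ℝ × E => V z.1 z.2) (Set.univ ×ˢ Ω))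
    (hper : ∀ θ, ∀ X ∈ Ω, V (θ + 2 * Real.pi) X = V θ X)
    (h1 : ∀ X ∈ Ω, ∀ θ θ' : ℝ, V θ X = 0 → V θ' X = 0 → (θ : Real.Angle) = (θ' : Real.Angle))
    (h2 : ∀ X ∈ Ω, ∀ θ : ℝ, V θ X = 0 → deriv (fun t => V t X) θ ≠ 0) {X : E} (hX : X ∈ Ω) :
    ∃ K > 0, ∃ U ⊆ Ω, IsOpen U ∧ X ∈ U ∧ LogLipDerivOn (meanNorm V) K U := by
  have hpi := Real.pi_pos
  have hV1 : ContDiffOn ℝ 1 (fun z : ℝ × E => V z.1 z.2) (Set.univ ×ˢ Ω) :=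
    hV.of_le one_le_two
  have hD := contDiffOn_fderiv_of_prod (k := 1) hΩ (by norm_num) hV
  have h0 : ∀ X ∈ Ω, ∀ᵐ θ : ℝ, θ ∈ Set.uIoc 0 (2 * Real.pi) → V θ X ≠ 0 := fun X hX =>
    (ae_ne_zero_of_angle_unique (h1 X hX)).mono fun θ hθ _ => hθ
  obtain ⟨c, hc, hc1, a, hev⟩ := exists_eventually_mul_abs_sub_le hΩ hV1 hX (h1 X hX) (h2 X hX)
  obtain ⟨C₁, hC₁, ε₁, hε₁, hb₁, hL₁⟩ := exists_ball_bound_lipschitz hΩ hV1 hX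
    (isCompact_Icc (a := a) (b := a + 2 * Real.pi))
  -- Applied to `∂V/∂X` to make it Lipschitz; this is where C² is used.
  obtain ⟨C₂, hC₂, ε₂, hε₂, hb₂, hL₂⟩ := exists_ball_bound_lipschitz
    (V := fun θ X => fderiv ℝ (V θ) X) hΩ hD hX (isCompact_Icc (a := a) (b := a + 2 * Real.pi))
  obtain ⟨ε₃, hε₃, hlow⟩ := Metric.eventually_nhds_iff_ball.1 hev
  set L := max (max C₁ C₂) 1 with hL
  have hLC₁ : C₁ ≤ L := (le_max_left _ _).trans (le_max_left _ _)
  have hLC₂ : C₂ ≤ L := (le_max_right _ _).trans (le_max_left _ _)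
  have hL1 : 1 ≤ L := le_max_right _ _
  -- Radius 1/16 keeps any two points of the ball within the distance 1/8 required by the
  -- logarithmic bounds.
  set r := min (min ε₁ ε₂) (min ε₃ (1 / 16)) with hr
  have hr₁ : Metric.ball X r ⊆ Metric.ball X ε₁ :=
    Metric.ball_subset_ball ((min_le_left _ _).trans (min_le_left _ _))
  have hr₂ : Metric.ball X r ⊆ Metric.ball X ε₂ :=
    Metric.ball_subset_ball ((min_le_left _ _).trans (min_le_right _ _))
  have hr₃ : Metric.ball X r ⊆ Metric.ball X ε₃ :=
    Metric.ball_subset_ball ((min_le_right _ _).trans (min_le_left _ _))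
  have hr₄ : r ≤ 1 / 16 := (min_le_right _ _).trans (min_le_right _ _)
  have hr0 : 0 < r := lt_min (lt_min hε₁ hε₂) (lt_min hε₃ (by norm_num))
  have hUΩ : Metric.ball X r ⊆ Ω := hr₁.trans hb₁
  refine ⟨(1 / (2 * Real.pi)) * (2 * Real.pi * L + 16 * L ^ 2 / c), by positivity,
    Metric.ball X r, hUΩ, Metric.isOpen_ball, Metric.mem_ball_self hr0,
    (contDiffOn_meanNorm hΩ hV1 h0).mono hUΩ, fun Y hY Z hZ => ?_⟩
  rcases eq_or_ne Y Z with rfl | hYZ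
  · simp
  have hρ : ‖Y - Z‖ ≤ 1 / 8 := by
    rw [← dist_eq_norm]
    have := dist_triangle_right Y Z X
    rw [Metric.mem_ball] at hY hZ
    linarith
  obtain ⟨τ, hτ, hle⟩ := hlow Y (hr₃ hY)
  have hshift : ∀ W ∈ Ω, ∫ θ in (0 : ℝ)..(2 * Real.pi), normDeriv V θ W =
      ∫ θ in a..(a + 2 * Real.pi), normDeriv V θ W := fun W hW => by
    simpa using (periodic_normDeriv hΩ hper hW).intervalIntegral_add_eq 0 a
  rw [(hasFDerivAt_meanNorm hΩ hV1 (hUΩ hY) (h0 Y (hUΩ hY))).fderiv,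
    (hasFDerivAt_meanNorm hΩ hV1 (hUΩ hZ) (h0 Z (hUΩ hZ))).fderiv,
    hshift Y (hUΩ hY), hshift Z (hUΩ hZ), ← smul_sub, norm_smul, Real.norm_eq_abs,
    abs_of_pos (by positivity), mul_assoc, mul_assoc]
  gcongr
  rw [← mul_assoc]
  refine norm_integral_normDeriv_sub_le hΩ hV1 (hUΩ hY) (hUΩ hZ) hc hc1 hL1 hτ hle
    (fun θ hθ => (hL₁ θ hθ Z (hr₁ hZ)).2.1.trans hLC₁)
    (fun θ hθ => ((hL₂ θ hθ Y (hr₂ hY)).2.2 Z (hr₂ hZ)).trans (by gcongr))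
    (fun θ hθ => ((hL₁ θ hθ Y (hr₁ hY)).2.2 Z (hr₁ hZ)).trans (by gcongr)) hYZ hρ

end MeanNorm

/-! ### The Hamiltonian in the coordinates of a chart -/

section Chart

lemma isOpen_coord {n : ℕ} {M : Type*} [TopologicalSpace M]
    {e : OpenPartialHomeomorph M (EuclideanSpace ℝ (Fin n))} :
    IsOpen {X : Coord n | X.fst ∈ e.target ∧ X.snd ≠ 0} := by
  have h1 : Continuous fun X : Coord n => X.fst := by fun_prop
  have h2 : Continuous fun X : Coord n => X.snd := by fun_prop
  exact (e.open_target.preimage h1).inter (isOpen_ne.preimage h2)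

variable {n m : ℕ} {M : Type*} [TopologicalSpace M]
  [ChartedSpace (EuclideanSpace ℝ (Fin n)) M]

lemma mdifferentiable_of_mem_maximalAtlas
    {e : OpenPartialHomeomorph M (EuclideanSpace ℝ (Fin n))}
    (he : e ∈ IsManifold.maximalAtlas (𝓡 n) ∞ M) : e.MDifferentiable (𝓡 n) (𝓡 n) :=
  ⟨(contMDiffOn_of_mem_maximalAtlas he).mdifferentiableOn (by simp),
    (contMDiffOn_symm_of_mem_maximalAtlas he).mdifferentiableOn (by simp)⟩

/-- The covector at `e⁻¹(y)` whose coordinates are `X = (y, q)`. -/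
noncomputable def covectorOf (e : OpenPartialHomeomorph M (EuclideanSpace ℝ (Fin n)))
    (X : Coord n) : TangentSpace (𝓡 n) (e.symm X.fst) →L[ℝ] ℝ :=
  X.snd ∘L (mfderiv (𝓡 n) 𝓘(ℝ, EuclideanSpace ℝ (Fin n)) e (e.symm X.fst) :
      TangentSpace (𝓡 n) (e.symm X.fst) →L[ℝ] EuclideanSpace ℝ (Fin n))

lemma covectorOf_ne_zero {e : OpenPartialHomeomorph M (EuclideanSpace ℝ (Fin n))}
    (he : e ∈ IsManifold.maximalAtlas (𝓡 n) ∞ M) {X : Coord n} (hX : X.fst ∈ e.target)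
    (hX0 : X.snd ≠ 0) : covectorOf e X ≠ 0 := by
  intro h
  apply hX0
  ext v
  obtain ⟨w, rfl⟩ := (mdifferentiable_of_mem_maximalAtlas he).mfderiv_surjective
    (e.map_target hX) v
  exact congrArg (fun f => f w) h

lemma coordOf_snd_ne_zero {e : OpenPartialHomeomorph M (EuclideanSpace ℝ (Fin n))}
    (he : e ∈ IsManifold.maximalAtlas (𝓡 n) ∞ M) {x : M} (hx : x ∈ e.source)
    {p : TangentSpace (𝓡 n) x →L[ℝ] ℝ} (hp : p ≠ 0) : (coordOf e x p).snd ≠ 0 := by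
  intro h
  apply hp
  let A := (mdifferentiable_of_mem_maximalAtlas he).mfderiv hx
  have hA : mfderiv (𝓡 n) 𝓘(ℝ, EuclideanSpace ℝ (Fin n)) e x = A := rfl
  have h' : p ∘L (mfderiv (𝓡 n) 𝓘(ℝ, EuclideanSpace ℝ (Fin n)) e x).inverse = 0 := h
  -- `inverse` is 0 on non-invertible maps, so the differential must first be exhibited as an
  -- equivalence.
  rw [hA, ContinuousLinearMap.inverse_equiv] at h'
  ext v
  simpa using congrArg (fun f => f (A v)) h'

variable [IsManifold (𝓡 n) ∞ M]

/-- The vector field `G_i` read in the chart `e`. -/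
noncomputable def System.chartField (S : System n m M)
    (e : OpenPartialHomeomorph M (EuclideanSpace ℝ (Fin n))) (i : Fin m) (θ : ℝ)
    (y : EuclideanSpace ℝ (Fin n)) : EuclideanSpace ℝ (Fin n) :=
  mfderiv (𝓡 n) 𝓘(ℝ, EuclideanSpace ℝ (Fin n)) e (e.symm y) (S.G θ i (e.symm y))

/-- The chart expression is the fiber component of the tangent map of e composed with the smooth
section and `e.symm`. -/
lemma System.contDiffOn_chartField (S : System n m M)
    {e : OpenPartialHomeomorph M (EuclideanSpace ℝ (Fin n))}
    (he : e ∈ IsManifold.maximalAtlas (𝓡 n) ∞ M) (i : Fin m) :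
    ContDiffOn ℝ ∞ (fun z : ℝ × EuclideanSpace ℝ (Fin n) => S.chartField e i z.1 z.2)
      (Set.univ ×ˢ e.target) := by
  have h1 : ContMDiffOn 𝓘(ℝ, ℝ × EuclideanSpace ℝ (Fin n)) (𝓘(ℝ, ℝ).prod (𝓡 n)) ∞
      (fun z : ℝ × EuclideanSpace ℝ (Fin n) => (z.1, e.symm z.2)) (Set.univ ×ˢ e.target) := by
    refine ContMDiffOn.prodMk contDiff_fst.contMDiff.contMDiffOn ?_
    exact (contMDiffOn_symm_of_mem_maximalAtlas he).comp
      (contDiff_snd.contMDiff.contMDiffOn) fun z hz => hz.2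
  have h2 := (S.smooth i).comp_contMDiffOn h1
  have h3 := (contMDiffOn_of_mem_maximalAtlas he).contMDiffOn_tangentMapWithin (m := ∞)
    (by simp) e.open_source.uniqueMDiffOn
  have h4 := (contMDiff_snd_tangentBundle_modelSpace (n := ∞) (EuclideanSpace ℝ (Fin n))
    (𝓡 n)).comp_contMDiffOn (h3.comp h2 fun z hz => e.map_target hz.2)
  refine (contMDiffOn_iff_contDiffOn.1 h4).congr fun z hz => ?_
  have hs : e.symm z.2 ∈ e.source := e.map_target hz.2
  exact (DFunLike.congr_fun (mfderivWithin_of_isOpen (I := 𝓡 n) (I' := 𝓡 n) (f := e)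
    e.open_source hs) (S.G z.1 i (e.symm z.2))).symm

/-- The components of `⟨p, G(θ, x)⟩` in the coordinates of `T*M` induced by the chart `e`. -/
noncomputable def System.chartPair (S : System n m M)
    (e : OpenPartialHomeomorph M (EuclideanSpace ℝ (Fin n))) (θ : ℝ) (X : Coord n) :
    EuclideanSpace ℝ (Fin m) :=
  WithLp.toLp 2 fun i => X.snd (S.chartField e i θ X.fst)

lemma System.pair_zero_covectorOf (S : System n m M)
    (e : OpenPartialHomeomorph M (EuclideanSpace ℝ (Fin n))) (θ : ℝ) (X : Coord n) :
    S.pair 0 θ (e.symm X.fst) (covectorOf e X) = S.chartPair e θ X := by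
  ext i
  simp only [System.pair, System.dG]
  rfl

lemma System.HCoord_eq_meanNorm (S : System n m M)
    (e : OpenPartialHomeomorph M (EuclideanSpace ℝ (Fin n))) :
    S.HCoord e = meanNorm (S.chartPair e) := by
  ext X
  change S.H (e.symm X.fst) (covectorOf e X) = _
  simp only [System.H, S.pair_zero_covectorOf e, meanNorm]

lemma System.contDiffOn_chartPair (S : System n m M)
    {e : OpenPartialHomeomorph M (EuclideanSpace ℝ (Fin n))}
    (he : e ∈ IsManifold.maximalAtlas (𝓡 n) ∞ M) :
    ContDiffOn ℝ ∞ (fun z : ℝ × Coord n => S.chartPair e z.1 z.2)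
      (Set.univ ×ˢ {X : Coord n | X.fst ∈ e.target ∧ X.snd ≠ 0}) := by
  have hL := (WithLp.prodContinuousLinearEquiv 2 ℝ (EuclideanSpace ℝ (Fin n))
    (EuclideanSpace ℝ (Fin n) →L[ℝ] ℝ)).contDiff (n := ∞)
  have h1 : ContDiff ℝ ∞ fun z : ℝ × Coord n => z.2.fst := hL.fst.comp contDiff_snd
  have h2 : ContDiff ℝ ∞ fun z : ℝ × Coord n => z.2.snd := hL.snd.comp contDiff_snd
  rw [contDiffOn_euclidean]
  intro i
  refine h2.contDiffOn.clm_apply ?_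
  exact (S.contDiffOn_chartField he i).comp (contDiff_fst.prodMk h1).contDiffOn
    fun z hz => ⟨trivial, hz.2.1⟩

/-- Smoothness is assumed in the tangent bundle; it descends to the fixed fiber because `de_x` is an
isomorphism independent of time. -/
lemma System.differentiable_G (S : System n m M)
    {e : OpenPartialHomeomorph M (EuclideanSpace ℝ (Fin n))}
    (he : e ∈ IsManifold.maximalAtlas (𝓡 n) ∞ M) (i : Fin m) {x : M} (hx : x ∈ e.source) :
    Differentiable ℝ (F := EuclideanSpace ℝ (Fin n)) fun t => S.G t i x := by
  intro θ
  let A : EuclideanSpace ℝ (Fin n) ≃L[ℝ] EuclideanSpace ℝ (Fin n) :=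
    (mdifferentiable_of_mem_maximalAtlas he).mfderiv hx
  have h := (hasDerivAt_of_prod (V := S.chartField e i) e.open_target
    ((S.contDiffOn_chartField he i).of_le (by simp)) (e.map_source hx) θ).differentiableAt
  refine A.comp_differentiableAt_iff.1 (h.congr_of_eventuallyEq
    (Filter.Eventually.of_forall fun t => ?_))
  simp only [System.chartField]
  rw [e.left_inv hx]
  rfl

/-- The covector does not depend on θ, so it commutes with `∂/∂θ`; simplicity of zeros in (i)
thereby becomes the same condition on the chart expression. -/
lemma System.hasDerivAt_chartPair (S : System n m M)
    {e : OpenPartialHomeomorph M (EuclideanSpace ℝ (Fin n))}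
    (he : e ∈ IsManifold.maximalAtlas (𝓡 n) ∞ M) {X : Coord n} (hX : X.fst ∈ e.target) (θ : ℝ) :
    HasDerivAt (fun t => S.chartPair e t X)
      (S.pair 1 θ (e.symm X.fst) (covectorOf e X)) θ := by
  refine (PiLp.continuousLinearEquiv 2 ℝ fun _ : Fin m => ℝ).symm.hasFDerivAt.comp_hasDerivAt θ
    (f := fun t i => X.snd (S.chartField e i t X.fst)) (hasDerivAt_pi.2 fun i => ?_)
  have hG : HasDerivAt (F := EuclideanSpace ℝ (Fin n)) (fun t => S.G t i (e.symm X.fst))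
      (S.dG 1 θ i (e.symm X.fst)) θ :=
    (S.differentiable_G he i (e.map_target hX) θ).hasDerivAt.congr_deriv
      (congrFun (iteratedDeriv_one (F := EuclideanSpace ℝ (Fin n))).symm θ)
  let p : EuclideanSpace ℝ (Fin n) →L[ℝ] ℝ := covectorOf e X
  exact p.hasFDerivAt.comp_hasDerivAt θ hG

end Chart

end FastOsc

theorem theorem3p14 :
    -- the averaged Hamiltonian of a fast oscillating control system
    (∀ (n m : ℕ) (M : Type*) [TopologicalSpace M] [ChartedSpace (EuclideanSpace ℝ (Fin n)) M]
      [IsManifold (𝓡 n) ∞ M] (S : FastOsc.System n m M),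
      -- full rank condition
      (∀ θ x, S.r θ x = n) →
      -- (i)
      (∀ (x : M) (p : TangentSpace (𝓡 n) x →L[ℝ] ℝ), p ≠ 0 →
        (∀ θ θ' : ℝ, S.pair 0 θ x p = 0 → S.pair 0 θ' x p = 0 →
          (θ : Real.Angle) = (θ' : Real.Angle)) ∧
        (∀ θ : ℝ, S.pair 0 θ x p = 0 → S.pair 1 θ x p ≠ 0)) →
      -- (ii)
      (∀ θ x, Module.finrank ℝ (LinearMap.range (S.opG 0 θ x)) = m) →
      ∀ (x : M) (p : TangentSpace (𝓡 n) x →L[ℝ] ℝ), p ≠ 0 →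
        ∀ e ∈ IsManifold.maximalAtlas (𝓡 n) ∞ M, x ∈ e.source →
          ∃ c > 0, ∃ U : Set (FastOsc.Coord n), IsOpen U ∧ FastOsc.coordOf e x p ∈ U ∧
            (∀ X ∈ U, X.fst ∈ e.target) ∧ FastOsc.LogLipDerivOn (S.HCoord e) c U) ∧
    -- averages of norms
    (∀ (d m : ℕ) (Ω : Set (EuclideanSpace ℝ (Fin d)))
      (V : ℝ → EuclideanSpace ℝ (Fin d) → EuclideanSpace ℝ (Fin m)),
      0 < d → IsOpen Ω → FastOsc.SmoothOnCircle Ω V →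
      -- first point
      ((∀ X ∈ Ω, volume {θ : ℝ | θ ∈ Set.Icc 0 (2 * Real.pi) ∧ V θ X = 0} = 0) →
        ContDiffOn ℝ 1 (FastOsc.avgNorm V) Ω ∧
        ∀ X ∈ Ω, ∀ h : EuclideanSpace ℝ (Fin d),
          IntervalIntegrable (fun θ => ⟪fderiv ℝ (V θ) X h, ‖V θ X‖⁻¹ • V θ X⟫)
            volume 0 (2 * Real.pi) ∧
          fderiv ℝ (FastOsc.avgNorm V) X h =
            (1 / (2 * Real.pi)) * ∫ θ in (0 : ℝ)..(2 * Real.pi),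
              ⟪fderiv ℝ (V θ) X h, ‖V θ X‖⁻¹ • V θ X⟫) ∧
      -- second point
      ((∀ X ∈ Ω, ∀ θ θ' : ℝ, V θ X = 0 → V θ' X = 0 →
          (θ : Real.Angle) = (θ' : Real.Angle)) →
        (∀ X ∈ Ω, ∀ θ : ℝ, V θ X = 0 → deriv (fun t => V t X) θ ≠ 0) →
        ∀ X ∈ Ω, (∃ θ, V θ X = 0) →
          ∃ K > 0, ∃ U ⊆ Ω, IsOpen U ∧ X ∈ U ∧
            FastOsc.LogLipDerivOn (FastOsc.avgNorm V) K U)) := by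
  refine ⟨fun n m M _ _ _ S _ hi _ x p hp e he hx => ?_, fun d m Ω V _ hΩ hV => ⟨fun h0 => ?_,
    fun h1 h2 X hX _ => FastOsc.exists_logLipDerivOn_meanNorm hΩ
      (hV.1.of_le (WithTop.coe_le_coe.2 le_top)) hV.2 h1 h2 hX⟩⟩
  -- Nonzero coordinates represent nonzero covectors, so (i) applies at every point of the
  -- coordinate domain.
  · have hcov := fun (X : FastOsc.Coord n) (hX : X.fst ∈ e.target ∧ X.snd ≠ 0) =>
      hi (e.symm X.fst) (FastOsc.covectorOf e X) (FastOsc.covectorOf_ne_zero he hX.1 hX.2)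
    obtain ⟨c, hc, U, hUΩ, hU, hXU, hlog⟩ := FastOsc.exists_logLipDerivOn_meanNorm
      (V := S.chartPair e) FastOsc.isOpen_coord
      ((S.contDiffOn_chartPair he).of_le (WithTop.coe_le_coe.2 le_top))
      (fun θ X _ => by simp only [FastOsc.System.chartPair, FastOsc.System.chartField, S.periodic])
      (fun X hX θ θ' hθ hθ' => (hcov X hX).1 θ θ'
        ((S.pair_zero_covectorOf e θ X).trans hθ) ((S.pair_zero_covectorOf e θ' X).trans hθ'))
      (fun X hX θ hθ => by
        rw [(S.hasDerivAt_chartPair he hX.1 θ).deriv]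
        exact (hcov X hX).2 θ ((S.pair_zero_covectorOf e θ X).trans hθ))
      (X := FastOsc.coordOf e x p) ⟨e.map_source hx, FastOsc.coordOf_snd_ne_zero he hx hp⟩
    refine ⟨c, hc, U, hU, hXU, fun X hX => (hUΩ hX).1, ?_⟩
    rwa [S.HCoord_eq_meanNorm e]
  · have hV1 : ContDiffOn ℝ 1 (fun z : ℝ × EuclideanSpace ℝ (Fin d) => V z.1 z.2)
        (Set.univ ×ˢ Ω) := hV.1.of_le (WithTop.coe_le_coe.2 le_top)
    have hae : ∀ X ∈ Ω, ∀ᵐ θ : ℝ, θ ∈ Set.uIoc 0 (2 * Real.pi) → V θ X ≠ 0 := fun X hX => by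
      filter_upwards [measure_eq_zero_iff_ae_notMem.1 (h0 X hX)] with θ hθ hmem hz
      rw [Set.uIoc_of_le (by positivity)] at hmem
      exact hθ ⟨Set.Ioc_subset_Icc_self hmem, hz⟩
    refine ⟨FastOsc.contDiffOn_meanNorm hΩ hV1 hae, fun X hX h => ?_⟩
    have hint := FastOsc.intervalIntegrable_normDeriv hΩ hV1 hX 0 (2 * Real.pi)
    have hder : fderiv ℝ (FastOsc.avgNorm V) X = _ :=
      (FastOsc.hasFDerivAt_meanNorm hΩ hV1 hX (hae X hX)).fderiv
    simp only [← FastOsc.normDeriv_apply]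
    refine ⟨⟨hint.1.apply_continuousLinearMap h, hint.2.apply_continuousLinearMap h⟩, ?_⟩
    rw [hder, _root_.smul_apply, smul_eq_mul, ContinuousLinearMap.intervalIntegral_apply hint]
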